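/- **Corollary 2.6 (finiteness of H-depth).** For a ring $A$ and a subring $B\subseteq A$ with $1_B=1_A$, let $C_n(A,B)=A\otimes_B\cdots\otimes_B A$ ($n$ factors $A$, $n\ge 1$) with its natural $A$-$A$-bimodule structure. The subring $B\subseteq A$ has *H-depth* $2n-1$ ($n\geq 1$) if for some positive integer $q$ there is an $A$-$A$-bimodule $K$ with $C_{n+1}(A,B)\oplus K\cong C_n(A,B)^q$ as $A$-$A$-bimodules. Let $d_H(B,A)$ be the minimum of the numbers $2n-1$ such that $B\subseteq A$ has H-depth $2n-1$, and $d_H(B,A)=\infty$ if there is none. Let $k$ be a field. 1. Let $A$ be a finite-dimensional $k$-algebra and $B\subseteq A$ a (unital) $k$-subalgebra. If $B^e=B\otimes_k B^{\mathrm{op}}$ has finite representation type, i.e. there are only finitely many isomorphism classes of finitely generated indecomposable $B^e$-modules, then $d_H(B,A)<\infty$. 2. Let $G$ be a finite group and $J$ a subgroup of $G$. Then the group algebras $B=k[J]\subseteq k[G]=A$ satisfy $d_H(B,A)<\infty$. -/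

import Mathlib

open scoped TensorProduct

universe u v w

namespace HDepth

/-! ### The tensor product of bimodules over a subring -/

section BalTensor

variable {A : Type*} [Ring A] (B : Subring A)
variable (M : Type*) [AddCommGroup M] [Module Aᵐᵒᵖ M]
variable (N : Type*) [AddCommGroup N] [Module A N]

/-- The subgroup of `M ⊗ N` (tensor product over the integers) generated by the elements
`m b ⊗ n - m ⊗ b n` with `b` in the subring `B`. Right actions are actions of the opposite ring. -/
def balRel : AddSubgroup (M ⊗[ℤ] N) :=
  AddSubgroup.closure
    {t | ∃ (m : M) (n : N), ∃ b ∈ B, t = (MulOpposite.op b • m) ⊗ₜ[ℤ] n - m ⊗ₜ[ℤ] (b • n)}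

/-- The tensor product `M ⊗_B N` of a right module `M` and a left module `N` over a subring `B`
of a (not necessarily commutative) ring `A`, both modules being restricted from `A` to `B`. -/
def BalTensor : Type _ := (M ⊗[ℤ] N) ⧸ balRel B M N

instance : AddCommGroup (BalTensor B M N) :=
  inferInstanceAs (AddCommGroup ((M ⊗[ℤ] N) ⧸ balRel B M N))

variable {M N}

/-- The quotient map from the tensor product over the integers. -/
def BalTensor.mkHom : M ⊗[ℤ] N →+ BalTensor B M N := QuotientAddGroup.mk' (balRel B M N)

/-- The pure tensor `m ⊗ n` in `M ⊗_B N`. -/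
def BalTensor.tmul (m : M) (n : N) : BalTensor B M N := BalTensor.mkHom B (m ⊗ₜ[ℤ] n)

theorem BalTensor.hom_ext {X : Type*} [AddCommGroup X] {f g : BalTensor B M N →+ X}
    (h : ∀ m n, f (BalTensor.tmul B m n) = g (BalTensor.tmul B m n)) : f = g := by
  have key : ∀ t, f (BalTensor.mkHom B t) = g (BalTensor.mkHom B t) := fun t => by
    induction t using TensorProduct.induction_on with
    | zero => simp
    | tmul m n => exact h m n
    | add x y hx hy => simp only [map_add, hx, hy]
  ext x
  obtain ⟨t, rfl⟩ := QuotientAddGroup.mk'_surjective (balRel B M N) x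
  exact key t

theorem BalTensor.add_tmul (m m' : M) (n : N) :
    BalTensor.tmul B (m + m') n = BalTensor.tmul B m n + BalTensor.tmul B m' n := by
  simp only [BalTensor.tmul, TensorProduct.add_tmul, map_add]

theorem BalTensor.tmul_add (m : M) (n n' : N) :
    BalTensor.tmul B m (n + n') = BalTensor.tmul B m n + BalTensor.tmul B m n' := by
  simp only [BalTensor.tmul, TensorProduct.tmul_add, map_add]

theorem BalTensor.zero_tmul (n : N) : BalTensor.tmul B (0 : M) n = 0 := by
  simp only [BalTensor.tmul, TensorProduct.zero_tmul, map_zero]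

theorem BalTensor.tmul_zero (m : M) : BalTensor.tmul B m (0 : N) = 0 := by
  simp only [BalTensor.tmul, TensorProduct.tmul_zero, map_zero]

theorem BalTensor.smul_tmul {b : A} (hb : b ∈ B) (m : M) (n : N) :
    BalTensor.tmul B (MulOpposite.op b • m) n = BalTensor.tmul B m (b • n) := by
  rw [← sub_eq_zero, BalTensor.tmul, BalTensor.tmul, ← map_sub]
  exact (QuotientAddGroup.eq_zero_iff _).2 (AddSubgroup.subset_closure ⟨m, n, b, hb, rfl⟩)

/-- The additive map `f ⊗ g` between tensor products over `B`. -/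
def BalTensor.map {M' : Type*} [AddCommGroup M'] [Module Aᵐᵒᵖ M']
    {N' : Type*} [AddCommGroup N'] [Module A N'] (f : M →+ M') (g : N →+ N')
    (hf : ∀ b ∈ B, ∀ m, f (MulOpposite.op b • m) = MulOpposite.op b • f m)
    (hg : ∀ b ∈ B, ∀ n, g (b • n) = b • g n) : BalTensor B M N →+ BalTensor B M' N' :=
  QuotientAddGroup.map _ _
    (TensorProduct.map f.toIntLinearMap g.toIntLinearMap).toAddMonoidHom <| by
      refine (AddSubgroup.closure_le _).2 ?_
      rintro _ ⟨m, n, b, hb, rfl⟩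
      refine AddSubgroup.subset_closure ⟨f m, g n, b, hb, ?_⟩
      simp [hf b hb, hg b hb]

theorem BalTensor.map_tmul {M' : Type*} [AddCommGroup M'] [Module Aᵐᵒᵖ M']
    {N' : Type*} [AddCommGroup N'] [Module A N'] (f : M →+ M') (g : N →+ N')
    (hf : ∀ b ∈ B, ∀ m, f (MulOpposite.op b • m) = MulOpposite.op b • f m)
    (hg : ∀ b ∈ B, ∀ n, g (b • n) = b • g n) (m : M) (n : N) :
    BalTensor.map B f g hf hg (BalTensor.tmul B m n) = BalTensor.tmul B (f m) (g n) := rfl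

variable (M N)

/-- The left action `a (m ⊗ n) = (a m) ⊗ n`, as a ring homomorphism to additive endomorphisms. -/
def BalTensor.leftHom [Module A M] [SMulCommClass A Aᵐᵒᵖ M] :
    A →+* AddMonoid.End (BalTensor B M N) where
  toFun a := BalTensor.map B (DistribSMul.toAddMonoidHom M a) (AddMonoidHom.id N)
    (fun b _ m => smul_comm a (MulOpposite.op b) m) (fun _ _ _ => rfl)
  map_one' := BalTensor.hom_ext B fun m n =>
    congrArg (fun x => BalTensor.tmul B x n) (one_smul _ m)
  map_zero' := BalTensor.hom_ext B fun m n =>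
    (congrArg (fun x => BalTensor.tmul B x n) (zero_smul _ m)).trans
      (BalTensor.zero_tmul B n)
  map_mul' a c := BalTensor.hom_ext B fun m n =>
    congrArg (fun x => BalTensor.tmul B x n) (mul_smul a c m)
  map_add' a c := BalTensor.hom_ext B fun m n =>
    (congrArg (fun x => BalTensor.tmul B x n) (add_smul a c m)).trans
      (BalTensor.add_tmul B (a • m) (c • m) n)

/-- The right action `(m ⊗ n) a = m ⊗ (n a)`. -/
def BalTensor.rightHom [Module Aᵐᵒᵖ N] [SMulCommClass A Aᵐᵒᵖ N] :
    Aᵐᵒᵖ →+* AddMonoid.End (BalTensor B M N) where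
  toFun a := BalTensor.map B (AddMonoidHom.id M) (DistribSMul.toAddMonoidHom N a)
    (fun _ _ _ => rfl) (fun b _ n => (smul_comm b a n).symm)
  map_one' := BalTensor.hom_ext B fun m n =>
    congrArg (fun x => BalTensor.tmul B m x) (one_smul _ n)
  map_zero' := BalTensor.hom_ext B fun m n =>
    (congrArg (fun x => BalTensor.tmul B m x) (zero_smul _ n)).trans
      (BalTensor.tmul_zero B m)
  map_mul' a c := BalTensor.hom_ext B fun m n =>
    congrArg (fun x => BalTensor.tmul B m x) (mul_smul a c n)
  map_add' a c := BalTensor.hom_ext B fun m n =>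
    (congrArg (fun x => BalTensor.tmul B m x) (add_smul a c n)).trans
      (BalTensor.tmul_add B m (a • n) (c • n))

instance [Module A M] [SMulCommClass A Aᵐᵒᵖ M] : Module A (BalTensor B M N) :=
  Module.compHom _ (BalTensor.leftHom B M N)

instance [Module Aᵐᵒᵖ N] [SMulCommClass A Aᵐᵒᵖ N] : Module Aᵐᵒᵖ (BalTensor B M N) :=
  Module.compHom _ (BalTensor.rightHom B M N)

variable {M N}

theorem BalTensor.left_smul_tmul [Module A M] [SMulCommClass A Aᵐᵒᵖ M] (a : A) (m : M) (n : N) :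
    a • BalTensor.tmul B m n = BalTensor.tmul B (a • m) n := rfl

theorem BalTensor.right_smul_tmul [Module Aᵐᵒᵖ N] [SMulCommClass A Aᵐᵒᵖ N]
    (a : Aᵐᵒᵖ) (m : M) (n : N) :
    a • BalTensor.tmul B m n = BalTensor.tmul B m (a • n) := rfl

variable (M N)

instance [Module A M] [SMulCommClass A Aᵐᵒᵖ M] [Module Aᵐᵒᵖ N] [SMulCommClass A Aᵐᵒᵖ N] :
    SMulCommClass A Aᵐᵒᵖ (BalTensor B M N) where
  smul_comm a c x := by
    have h : (BalTensor.leftHom B M N a).comp (BalTensor.rightHom B M N c) =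
        (BalTensor.rightHom B M N c).comp (BalTensor.leftHom B M N a) :=
      BalTensor.hom_ext B fun m n => rfl
    exact DFunLike.congr_fun h x

end BalTensor

/-! ### The bimodules `C_n(A,B)` and H-depth -/

/-- Bimodules over a ring `A`: left and right actions of `A` that commute. -/
structure Bimod (A : Type*) [Ring A] where
  /-- the underlying type -/
  carrier : Type*
  [isAddCommGroup : AddCommGroup carrier]
  [isLeftModule : Module A carrier]
  [isRightModule : Module Aᵐᵒᵖ carrier]
  [isSMulCommClass : SMulCommClass A Aᵐᵒᵖ carrier]

attribute [instance] Bimod.isAddCommGroup Bimod.isLeftModule Bimod.isRightModule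
  Bimod.isSMulCommClass

/-- `P ≅ Q` as `A`-bimodules. -/
def BimodIso (A : Type*) [Ring A]
    (P : Type*) [AddCommGroup P] [Module A P] [Module Aᵐᵒᵖ P]
    (Q : Type*) [AddCommGroup Q] [Module A Q] [Module Aᵐᵒᵖ Q] : Prop :=
  ∃ e : P ≃+ Q, (∀ (a : A) (x : P), e (a • x) = a • e x) ∧
    ∀ (a : Aᵐᵒᵖ) (x : P), e (a • x) = a • e x

/-- `tensorPower B n` is the `A`-bimodule `A ⊗_B ⋯ ⊗_B A` with `n + 1` factors `A`,
that is `C_{n+1}(A,B)`. -/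
def tensorPower {A : Type u} [Ring A] (B : Subring A) : ℕ → Bimod.{u, u} A
  | 0 => { carrier := A }
  | n + 1 => { carrier := BalTensor B A (tensorPower B n).carrier }

/-- The subring `B ⊆ A` has H-depth `2n + 1`: for some positive integer `q` there is an
`A`-bimodule `K` with `C_{n+2}(A,B) ⊕ K ≅ C_{n+1}(A,B)^q` as `A`-bimodules. -/
def HasHDepth {A : Type u} [Ring A] (B : Subring A) (n : ℕ) : Prop :=
  ∃ q : ℕ, 0 < q ∧ ∃ K : Bimod.{u, u} A,
    BimodIso A ((tensorPower B (n + 1)).carrier × K.carrier)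
      (Fin q → (tensorPower B n).carrier)

/-- The minimum H-depth `d_H(B,A)`, equal to `⊤` if `B ⊆ A` has no finite H-depth. -/
noncomputable def minHDepth {A : Type u} [Ring A] (B : Subring A) : ℕ∞ :=
  sInf {d : ℕ∞ | ∃ n : ℕ, HasHDepth B n ∧ d = 2 * n + 1}

/-! ### Finite representation type -/

/-- A module is indecomposable if it is nonzero and is not the direct sum of two nonzero
submodules. -/
def IsIndecomposable (R : Type*) [Ring R] (M : Type*) [AddCommGroup M] [Module R M] : Prop :=
  Nontrivial M ∧ ∀ P Q : Submodule R M, IsCompl P Q → P = ⊥ ∨ Q = ⊥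

/-- There are only finitely many isomorphism classes of finitely generated indecomposable
`R`-modules. (Every finitely generated module is isomorphic to one in the universe of `R`.) -/
def FiniteRepType (R : Type u) [Ring R] : Prop :=
  ∃ (r : ℕ) (X : Fin r → ModuleCat.{u} R), ∀ (M : Type u) [AddCommGroup M] [Module R M],
    Module.Finite R M → IsIndecomposable R M → ∃ i, Nonempty (M ≃ₗ[R] X i)

/-! ### Group algebras of a subgroup pair -/

/-- The group algebra `k[J]`, as a subalgebra of `k[G]`. -/
noncomputable def groupSubalgebra (k : Type*) [Field k] {G : Type*} [Group G] (J : Subgroup G) :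
    Subalgebra k (MonoidAlgebra k G) :=
  (MonoidAlgebra.mapDomainAlgHom k k J.subtype).range

end HDepth

/-! H-depth `2n+1` holds as soon as the identity of $C_{n+2}$ is a finite sum of bimodule maps
factoring through $C_{n+1}$. This form of "direct summand of a finite power" (`BiDivides`) is
carried along by tensoring, and a kernel then supplies the complement $K$ (`exists_complement`,
`HasHDepth.of_biDivides`).

Finite representation type: multiplication $A\otimes_B C_n\to C_n$ is split over $B$-$B$ by
$x\mapsto 1\otimes x$, so each $C_n$ is a $B^e$-direct summand of $C_{n+1}$. The set of listed
modules occurring as summands of $C_n$ therefore increases with $n$ inside a finite set, and stops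
growing. From then on every indecomposable summand of $C_{n+1}$ is already a summand of $C_n$, so
$C_{n+1}$ divides a power of $C_n$ over $B^e$ (`FiniteRepType.exists_divides`). Applying
$A\otimes_B-\otimes_B A$ turns this into a statement about $A$-$A$-bimodules, two factors higher
(`HasHDepth.of_biDivides_subring`).

Group algebras: no hypothesis on representation type is needed. $C_{n+1}(k[G],k[J])$ is the
permutation bimodule on $(G/J)^n\times G$ (`exists_tensorPower_equiv`). If $n=|G/J|$, each
$(n+1)$-tuple of cosets has a repeated entry; deleting it is reversible and $G$-equivariant, so the
bimodule on $(n+1)$-tuples splits into finitely many pieces, each a summand of the one on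
$n$-tuples. -/

namespace HDepth

/-! ### Maps out of the balanced tensor product -/

section Balanced

variable {A : Type*} [Ring A] {B : Subring A}
variable {M : Type*} [AddCommGroup M] [Module Aᵐᵒᵖ M]
variable {N : Type*} [AddCommGroup N] [Module A N]
variable {X : Type*} [AddCommGroup X]

theorem BalTensor.induction_on {p : BalTensor B M N → Prop} (x : BalTensor B M N)
    (zero : p 0) (tmul : ∀ m n, p (BalTensor.tmul B m n))
    (add : ∀ x y, p x → p y → p (x + y)) : p x := by
  obtain ⟨t, rfl⟩ := QuotientAddGroup.mk'_surjective (balRel B M N) x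
  induction t using TensorProduct.induction_on with
  | zero => exact zero
  | tmul m n => exact tmul m n
  | add x y hx hy => rw [map_add]; exact add _ _ hx hy

/-- The additive map out of `M ⊗_B N` given by a balanced biadditive map. -/
def BalTensor.lift (f : M →+ N →+ X)
    (hf : ∀ b ∈ B, ∀ m n, f (MulOpposite.op b • m) n = f m (b • n)) : BalTensor B M N →+ X :=
  QuotientAddGroup.lift (balRel B M N)
    (TensorProduct.liftAddHom (R := ℤ) f fun r m n => by simp) <| by
      refine (AddSubgroup.closure_le _).2 ?_
      rintro _ ⟨m, n, b, hb, rfl⟩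
      simp [AddMonoidHom.mem_ker, hf b hb]

variable (B) in
/-- The biadditive map `(m, n) ↦ m ⊗ n`. -/
def BalTensor.tmulHom (M : Type*) [AddCommGroup M] [Module Aᵐᵒᵖ M]
    (N : Type*) [AddCommGroup N] [Module A N] : M →+ N →+ BalTensor B M N :=
  AddMonoidHom.mk' (fun m => AddMonoidHom.mk' (fun n => BalTensor.tmul B m n)
    fun n n' => BalTensor.tmul_add B m n n') fun m m' =>
      AddMonoidHom.ext fun n => BalTensor.add_tmul B m m' n

end Balanced

/-! ### Associativity of the balanced tensor product -/

section Assoc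

variable {A : Type*} [Ring A] (B : Subring A)
variable (L : Type*) [AddCommGroup L] [Module Aᵐᵒᵖ L]
variable (M : Type*) [AddCommGroup M] [Module A M] [Module Aᵐᵒᵖ M] [SMulCommClass A Aᵐᵒᵖ M]
variable (N : Type*) [AddCommGroup N] [Module A N]

/-- The map `(l ⊗ m) ⊗ n ↦ l ⊗ (m ⊗ n)`. -/
def BalTensor.assocHom :
    BalTensor B (BalTensor B L M) N →+ BalTensor B L (BalTensor B M N) :=
  BalTensor.lift (AddMonoidHom.flip <| AddMonoidHom.mk'
      (fun n => BalTensor.map B (AddMonoidHom.id L) ((BalTensor.tmulHom B M N).flip n)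
        (fun _ _ _ => rfl) fun _ _ _ => rfl)
      fun n n' => BalTensor.hom_ext B fun l m => by
        exact (congrArg (BalTensor.tmul B l) (BalTensor.tmul_add B m n n')).trans
          (BalTensor.tmul_add B l _ _))
    fun b hb x n => by
      induction x using BalTensor.induction_on with
      | zero => simp
      | tmul l m => exact congrArg (BalTensor.tmul B l) (BalTensor.smul_tmul B hb m n)
      | add x y hx hy => rw [smul_add, map_add, map_add, AddMonoidHom.add_apply,
          AddMonoidHom.add_apply, hx, hy]

/-- The map `l ⊗ (m ⊗ n) ↦ (l ⊗ m) ⊗ n`. -/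
def BalTensor.assocInvHom :
    BalTensor B L (BalTensor B M N) →+ BalTensor B (BalTensor B L M) N :=
  BalTensor.lift (AddMonoidHom.mk'
      (fun l => BalTensor.map B (BalTensor.tmulHom B L M l) (AddMonoidHom.id N)
        (fun _ _ _ => rfl) fun _ _ _ => rfl)
      fun l l' => BalTensor.hom_ext B fun m n => by
        exact (congrArg (fun y => BalTensor.tmul B y n) (BalTensor.add_tmul B l l' m)).trans
          (BalTensor.add_tmul B _ _ n))
    fun b hb l x => by
      induction x using BalTensor.induction_on with
      | zero => simp
      | tmul m n =>
        exact congrArg (fun y => BalTensor.tmul B y n) (BalTensor.smul_tmul B hb l m)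
      | add x y hx hy => rw [smul_add, map_add, map_add, hx, hy]

/-- Associativity of the tensor product over `B`. -/
def BalTensor.assoc :
    BalTensor B (BalTensor B L M) N ≃+ BalTensor B L (BalTensor B M N) where
  __ := BalTensor.assocHom B L M N
  invFun := BalTensor.assocInvHom B L M N
  left_inv x := by
    change BalTensor.assocInvHom B L M N (BalTensor.assocHom B L M N x) = x
    induction x using BalTensor.induction_on with
    | zero => simp
    | tmul y n =>
      induction y using BalTensor.induction_on with
      | zero => simp [BalTensor.zero_tmul]
      | tmul l m => rfl
      | add x y hx hy => rw [BalTensor.add_tmul, map_add, map_add, hx, hy]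
    | add x y hx hy => rw [map_add, map_add, hx, hy]
  right_inv x := by
    change BalTensor.assocHom B L M N (BalTensor.assocInvHom B L M N x) = x
    induction x using BalTensor.induction_on with
    | zero => simp
    | tmul l y =>
      induction y using BalTensor.induction_on with
      | zero => simp [BalTensor.tmul_zero]
      | tmul m n => rfl
      | add x y hx hy => rw [BalTensor.tmul_add, map_add, map_add, hx, hy]
    | add x y hx hy => rw [map_add, map_add, hx, hy]

end Assoc

/-! ### Summands of finite powers, and induction from $B$ to $A$ -/

section BiDivides

/-- An additive map commuting with the left actions of `S` and the right actions of `T`. -/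
structure IsBiLinear {A : Type*} [Ring A] (S T : Set A)
    {P : Type*} [AddCommGroup P] [Module A P] [Module Aᵐᵒᵖ P]
    {Q : Type*} [AddCommGroup Q] [Module A Q] [Module Aᵐᵒᵖ Q] (f : P →+ Q) : Prop where
  left : ∀ a ∈ S, ∀ x, f (a • x) = a • f x
  right : ∀ a ∈ T, ∀ x, f (MulOpposite.op a • x) = MulOpposite.op a • f x

/-- `P` is a direct summand of a finite power of `Q`, with respect to additive maps commuting with
the left actions of `S` and the right actions of `T`: the identity of `P` is a finite sum of maps
factoring through `Q`. -/
def BiDivides {A : Type*} [Ring A] (S T : Set A)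
    (P : Type*) [AddCommGroup P] [Module A P] [Module Aᵐᵒᵖ P]
    (Q : Type*) [AddCommGroup Q] [Module A Q] [Module Aᵐᵒᵖ Q] : Prop :=
  ∃ (ι : Type) (_ : Fintype ι) (f : ι → P →+ Q) (g : ι → Q →+ P),
    (∀ i, IsBiLinear S T (f i)) ∧ (∀ i, IsBiLinear S T (g i)) ∧ ∀ x, ∑ i, g i (f i x) = x

variable {A : Type*} [Ring A]
variable {P : Type*} [AddCommGroup P] [Module A P] [Module Aᵐᵒᵖ P]
variable {Q : Type*} [AddCommGroup Q] [Module A Q] [Module Aᵐᵒᵖ Q]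

theorem BiDivides.congr {S T : Set A}
    {P' : Type*} [AddCommGroup P'] [Module A P'] [Module Aᵐᵒᵖ P']
    {Q' : Type*} [AddCommGroup Q'] [Module A Q'] [Module Aᵐᵒᵖ Q']
    (h : BiDivides S T P Q) (e : P ≃+ P') (he : IsBiLinear S T e.toAddMonoidHom)
    (e' : Q ≃+ Q') (he' : IsBiLinear S T e'.toAddMonoidHom) : BiDivides S T P' Q' := by
  obtain ⟨ι, _, f, g, hf, hg, hfg⟩ := h
  have hel : ∀ a ∈ S, ∀ x, e (a • x) = a • e x := he.left
  have her : ∀ a ∈ T, ∀ x, e (MulOpposite.op a • x) = MulOpposite.op a • e x := he.right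
  have hel' : ∀ a ∈ S, ∀ x, e' (a • x) = a • e' x := he'.left
  have her' : ∀ a ∈ T, ∀ x, e' (MulOpposite.op a • x) = MulOpposite.op a • e' x := he'.right
  have hsl : ∀ a ∈ S, ∀ x, e.symm (a • x) = a • e.symm x := fun a ha x => by
    rw [AddEquiv.symm_apply_eq, hel a ha, e.apply_symm_apply]
  have hsr : ∀ a ∈ T, ∀ x, e.symm (MulOpposite.op a • x) = MulOpposite.op a • e.symm x :=
    fun a ha x => by rw [AddEquiv.symm_apply_eq, her a ha, e.apply_symm_apply]
  have hsl' : ∀ a ∈ S, ∀ x, e'.symm (a • x) = a • e'.symm x := fun a ha x => by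
    rw [AddEquiv.symm_apply_eq, hel' a ha, e'.apply_symm_apply]
  have hsr' : ∀ a ∈ T, ∀ x, e'.symm (MulOpposite.op a • x) = MulOpposite.op a • e'.symm x :=
    fun a ha x => by rw [AddEquiv.symm_apply_eq, her' a ha, e'.apply_symm_apply]
  refine ⟨ι, inferInstance,
    fun i => (e'.toAddMonoidHom.comp (f i)).comp e.symm.toAddMonoidHom,
    fun i => (e.toAddMonoidHom.comp (g i)).comp e'.symm.toAddMonoidHom,
    fun i => ⟨fun a ha x => ?_, fun a ha x => ?_⟩,
    fun i => ⟨fun a ha x => ?_, fun a ha x => ?_⟩, fun x => ?_⟩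
  · simp [hsl a ha, (hf i).left a ha, hel' a ha]
  · simp [hsr a ha, (hf i).right a ha, her' a ha]
  · simp [hsl' a ha, (hg i).left a ha, hel a ha]
  · simp [hsr' a ha, (hg i).right a ha, her a ha]
  · simp [← map_sum, hfg]

/-- Tensoring on the left with `A` turns left `B`-linear maps into left `A`-linear ones. -/
theorem BiDivides.tensorLeft (B : Subring A) {T : Set A}
    [SMulCommClass A Aᵐᵒᵖ P] [SMulCommClass A Aᵐᵒᵖ Q] (h : BiDivides (B : Set A) T P Q) :
    BiDivides Set.univ T (BalTensor B A P) (BalTensor B A Q) := by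
  obtain ⟨ι, _, f, g, hf, hg, hfg⟩ := h
  refine ⟨ι, inferInstance,
    fun i => BalTensor.map B (AddMonoidHom.id A) (f i) (fun _ _ _ => rfl) (hf i).left,
    fun i => BalTensor.map B (AddMonoidHom.id A) (g i) (fun _ _ _ => rfl) (hg i).left,
    fun i => ⟨fun a _ x => ?_, fun a ha x => ?_⟩,
    fun i => ⟨fun a _ x => ?_, fun a ha x => ?_⟩, fun x => ?_⟩ <;>
  induction x using BalTensor.induction_on with
  | zero => simp
  | add x y hx hy =>
    first
    | rw [smul_add, map_add, hx, hy, map_add, smul_add]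
    | simp only [map_add, Finset.sum_add_distrib, hx, hy]
  | tmul m n =>
    simp only [BalTensor.left_smul_tmul, BalTensor.right_smul_tmul, BalTensor.map_tmul,
      AddMonoidHom.id_apply]
    try first
    | rw [(hf i).right a ha]
    | rw [(hg i).right a ha]
    | exact (map_sum (BalTensor.tmulHom B A P m) _ _).symm.trans
        (congrArg (BalTensor.tmul B m) (hfg n))

/-- Tensoring on the right with `A` turns right `B`-linear maps into right `A`-linear ones. -/
theorem BiDivides.tensorRight (B : Subring A) {S : Set A}
    [SMulCommClass A Aᵐᵒᵖ P] [SMulCommClass A Aᵐᵒᵖ Q] (h : BiDivides S (B : Set A) P Q) :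
    BiDivides S Set.univ (BalTensor B P A) (BalTensor B Q A) := by
  obtain ⟨ι, _, f, g, hf, hg, hfg⟩ := h
  refine ⟨ι, inferInstance,
    fun i => BalTensor.map B (f i) (AddMonoidHom.id A) (hf i).right (fun _ _ _ => rfl),
    fun i => BalTensor.map B (g i) (AddMonoidHom.id A) (hg i).right (fun _ _ _ => rfl),
    fun i => ⟨fun a ha x => ?_, fun a _ x => ?_⟩,
    fun i => ⟨fun a ha x => ?_, fun a _ x => ?_⟩, fun x => ?_⟩ <;>
  induction x using BalTensor.induction_on with
  | zero => simp
  | add x y hx hy =>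
    first
    | rw [smul_add, map_add, hx, hy, map_add, smul_add]
    | simp only [map_add, Finset.sum_add_distrib, hx, hy]
  | tmul m n =>
    simp only [BalTensor.left_smul_tmul, BalTensor.right_smul_tmul, BalTensor.map_tmul,
      AddMonoidHom.id_apply]
    try first
    | rw [(hf i).left a ha]
    | rw [(hg i).left a ha]
    | exact (map_sum ((BalTensor.tmulHom B P A).flip n) _ _).symm.trans
        (congrArg (fun y => BalTensor.tmul B y n) (hfg m))

end BiDivides

/-! ### From divisibility of bimodules to H-depth -/

section Criterion

/-- A split epimorphism of bimodules has a kernel which is a complement. -/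
theorem exists_complement {A : Type*} [Ring A]
    {P : Type*} [AddCommGroup P] [Module A P] [Module Aᵐᵒᵖ P]
    {Q : Type u} [AddCommGroup Q] [Module A Q] [Module Aᵐᵒᵖ Q] [SMulCommClass A Aᵐᵒᵖ Q]
    (s : Q →+ P) (j : P →+ Q) (hs : IsBiLinear (Set.univ : Set A) Set.univ s)
    (hj : IsBiLinear (Set.univ : Set A) Set.univ j) (hsj : ∀ x, s (j x) = x) :
    ∃ K : Bimod.{_, u} A, BimodIso A (P × K.carrier) Q := by
  have hl : ∀ (a : A) (x : Q), s x = 0 → s (a • x) = 0 := fun a x hx => by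
    rw [hs.left a trivial, hx, smul_zero]
  have hr : ∀ (a : Aᵐᵒᵖ) (x : Q), s x = 0 → s (a • x) = 0 := fun a x hx => by
    rw [← MulOpposite.op_unop a, hs.right _ trivial, hx, smul_zero]
  let _ : Module A s.ker :=
    { smul := fun a x => ⟨a • x.1, hl a _ x.2⟩
      one_smul := fun x => Subtype.ext (one_smul _ _)
      mul_smul := fun a c x => Subtype.ext (mul_smul _ _ _)
      smul_zero := fun a => Subtype.ext (smul_zero _)
      smul_add := fun a x y => Subtype.ext (smul_add _ _ _)
      add_smul := fun a c x => Subtype.ext (add_smul _ _ _)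
      zero_smul := fun x => Subtype.ext (zero_smul _ _) }
  let _ : Module Aᵐᵒᵖ s.ker :=
    { smul := fun a x => ⟨a • x.1, hr a _ x.2⟩
      one_smul := fun x => Subtype.ext (one_smul _ _)
      mul_smul := fun a c x => Subtype.ext (mul_smul _ _ _)
      smul_zero := fun a => Subtype.ext (smul_zero _)
      smul_add := fun a x y => Subtype.ext (smul_add _ _ _)
      add_smul := fun a c x => Subtype.ext (add_smul _ _ _)
      zero_smul := fun x => Subtype.ext (zero_smul _ _) }
  have : SMulCommClass A Aᵐᵒᵖ s.ker := ⟨fun a c x => Subtype.ext (smul_comm _ _ _)⟩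
  refine ⟨{ carrier := s.ker }, ?_⟩
  refine ⟨{ toFun := fun x => j x.1 + x.2.1
            invFun := fun y => (s y, ⟨y - j (s y), by
              rw [AddMonoidHom.mem_ker, map_sub, hsj, sub_self]⟩)
            left_inv := fun x => ?_
            right_inv := fun y => by simp
            map_add' := fun x y => ?_ }, fun a x => ?_, fun a x => ?_⟩
  · have hx : s x.2.1 = 0 := x.2.2
    refine Prod.ext (by simp [hsj, hx]) (Subtype.ext ?_)
    simp [hsj, hx]
  · change j (x.1 + y.1) + (x.2.1 + y.2.1) = _
    rw [map_add]; abel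
  · change j (a • x.1) + a • x.2.1 = a • (j x.1 + x.2.1)
    rw [hj.left a trivial, smul_add]
  · change j (a • x.1) + a • x.2.1 = a • (j x.1 + x.2.1)
    rw [← MulOpposite.op_unop a, hj.right _ trivial, smul_add]

theorem HasHDepth.of_biDivides {A : Type u} [Ring A] {B : Subring A} {n : ℕ}
    (h : BiDivides (Set.univ : Set A) Set.univ (tensorPower B (n + 1)).carrier
      (tensorPower B n).carrier) : HasHDepth B n := by
  obtain ⟨ι, _, f, g, hf, hg, hfg⟩ := h
  let e := Fintype.equivFin ι
  -- One coordinate more than the index set requires, since `ι` may be empty while $q$ must be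
  -- positive. The inclusion is zero on this last coordinate and the projection ignores it.
  refine ⟨Fintype.card ι + 1, Nat.succ_pos _, ?_⟩
  refine exists_complement
    (AddMonoidHom.mk' (fun y => ∑ i, g i (y (e i).castSucc)) fun x y => by
      simp [Finset.sum_add_distrib])
    (AddMonoidHom.mk' (fun x => Fin.lastCases 0 fun l => f (e.symm l) x) fun x y => ?_)
    ⟨fun a _ x => ?_, fun a _ x => ?_⟩ ⟨fun a _ x => ?_, fun a _ x => ?_⟩ fun x => ?_
  · ext l
    induction l using Fin.lastCases <;> simp
  · simp [(hg _).left a trivial, Finset.smul_sum]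
  · simp [(hg _).right a trivial, Finset.smul_sum]
  · ext l
    induction l using Fin.lastCases <;> simp [(hf _).left a trivial]
  · ext l
    induction l using Fin.lastCases <;> simp [(hf _).right a trivial]
  · simp [hfg]

theorem HasHDepth.minHDepth_lt_top {A : Type u} [Ring A] {B : Subring A} {n : ℕ}
    (h : HasHDepth B n) : minHDepth B < ⊤ := by
  refine lt_of_le_of_lt (sInf_le ⟨n, h, rfl⟩) ?_
  exact_mod_cast ENat.natCast_lt_top (2 * n + 1)

end Criterion

/-! ### Adding factors on both sides of a tensor power -/

section TensorPower

variable {A : Type u} [Ring A] (B : Subring A)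

/-- `C_n ⊗_B A ≅ C_{n+1}` as `A`-bimodules. -/
theorem exists_tensorPower_tensorRight (n : ℕ) :
    ∃ e : BalTensor B (tensorPower B n).carrier A ≃+ (tensorPower B (n + 1)).carrier,
      IsBiLinear (Set.univ : Set A) Set.univ e.toAddMonoidHom := by
  induction n with
  | zero => exact ⟨AddEquiv.refl _, fun _ _ _ => rfl, fun _ _ _ => rfl⟩
  | succ n ih =>
    obtain ⟨e, he⟩ := ih
    have hl : ∀ (a : A) x, e (a • x) = a • e x := fun a => he.left a trivial
    have hr : ∀ (a : A) x, e (MulOpposite.op a • x) = MulOpposite.op a • e x :=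
      fun a => he.right a trivial
    have hl' : ∀ (a : A) x, e.symm (a • x) = a • e.symm x := fun a x => by
      rw [AddEquiv.symm_apply_eq, hl, e.apply_symm_apply]
    let F : BalTensor B A (BalTensor B (tensorPower B n).carrier A) ≃+
        BalTensor B A (tensorPower B (n + 1)).carrier :=
      { __ := BalTensor.map B (AddMonoidHom.id A) e.toAddMonoidHom (fun _ _ _ => rfl)
          fun b _ => hl b
        invFun := BalTensor.map B (AddMonoidHom.id A) e.symm.toAddMonoidHom (fun _ _ _ => rfl)
          fun b _ => hl' b
        left_inv := DFunLike.congr_fun (f := (BalTensor.map B (AddMonoidHom.id A)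
            e.symm.toAddMonoidHom (fun _ _ _ => rfl) fun b _ => hl' b).comp
            (BalTensor.map B (AddMonoidHom.id A) e.toAddMonoidHom (fun _ _ _ => rfl)
              fun b _ => hl b)) (g := AddMonoidHom.id _)
          (BalTensor.hom_ext B fun m n => by simp [BalTensor.map_tmul])
        right_inv := DFunLike.congr_fun (f := (BalTensor.map B (AddMonoidHom.id A)
            e.toAddMonoidHom (fun _ _ _ => rfl) fun b _ => hl b).comp
            (BalTensor.map B (AddMonoidHom.id A) e.symm.toAddMonoidHom (fun _ _ _ => rfl)
              fun b _ => hl' b)) (g := AddMonoidHom.id _)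
          (BalTensor.hom_ext B fun m n => by simp [BalTensor.map_tmul]) }
    have hF : ∀ m x, F (BalTensor.tmul B m x) = BalTensor.tmul B m (e x) := fun _ _ => rfl
    -- The factors of `tensorPower` are added on the left; a new right-hand factor is brought inside
    -- by reassociating and absorbed there by the inductive `e`.
    let E : BalTensor B (BalTensor B A (tensorPower B n).carrier) A ≃+
        BalTensor B A (tensorPower B (n + 1)).carrier := (BalTensor.assoc B A _ A).trans F
    have hE : ∀ a m c, E (BalTensor.tmul B (BalTensor.tmul B a m) c) =
      BalTensor.tmul B a (e (BalTensor.tmul B m c)) := fun _ _ _ => rfl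
    refine ⟨E, fun a _ x => ?_, fun a _ x => ?_⟩
    · change E (a • x) = (a • E x : BalTensor B A (tensorPower B (n + 1)).carrier)
      revert x
      refine DFunLike.congr_fun (f := E.toAddMonoidHom.comp (DistribSMul.toAddMonoidHom _ a))
        (g := (DistribSMul.toAddMonoidHom _ a).comp E.toAddMonoidHom)
        (BalTensor.hom_ext B fun x c => ?_)
      induction x using BalTensor.induction_on with
      | zero => simp [BalTensor.zero_tmul]
      | tmul l m => rfl
      | add x y hx hy => rw [BalTensor.add_tmul, map_add, map_add, hx, hy]
    · change E (_ • x) = (_ • E x : BalTensor B A (tensorPower B (n + 1)).carrier)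
      revert x
      refine DFunLike.congr_fun
        (f := E.toAddMonoidHom.comp (DistribSMul.toAddMonoidHom _ (MulOpposite.op a)))
        (g := (DistribSMul.toAddMonoidHom _ (MulOpposite.op a)).comp E.toAddMonoidHom)
        (BalTensor.hom_ext B fun x c => ?_)
      induction x using BalTensor.induction_on with
      | zero => simp [BalTensor.zero_tmul]
      | tmul l m => exact congrArg (BalTensor.tmul B l) (hr a (BalTensor.tmul B m c))
      | add x y hx hy => rw [BalTensor.add_tmul, map_add, map_add, hx, hy]

/-- Inducing on the left and on the right upgrades $B$-linearity to $A$-linearity on each side. Each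
induction adds one factor, whence `n + 2`. On the left this is the recursion defining `tensorPower`;
on the right it goes through `exists_tensorPower_tensorRight`. -/
theorem HasHDepth.of_biDivides_subring {n : ℕ}
    (h : BiDivides (B : Set A) (B : Set A) (tensorPower B (n + 1)).carrier
      (tensorPower B n).carrier) : HasHDepth B (n + 2) := by
  obtain ⟨e, he⟩ := exists_tensorPower_tensorRight B (n + 2)
  obtain ⟨e', he'⟩ := exists_tensorPower_tensorRight B (n + 1)
  have h1 : BiDivides Set.univ (B : Set A) (tensorPower B (n + 2)).carrier
      (tensorPower B (n + 1)).carrier := h.tensorLeft B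
  exact HasHDepth.of_biDivides ((h1.tensorRight B).congr e he e' he')

end TensorPower

/-! ### Stabilisation of chains over a ring of finite representation type -/

section FiniteType

variable (R : Type*) [Ring R]

/-- `M` is isomorphic to a direct summand of `N`. -/
def IsRetract (M : Type*) [AddCommGroup M] [Module R M] (N : Type*) [AddCommGroup N]
    [Module R N] : Prop :=
  ∃ (i : M →ₗ[R] N) (p : N →ₗ[R] M), ∀ x, p (i x) = x

/-- `M` is a direct summand of a finite power of `N`: the identity of `M` is a finite sum of maps
factoring through `N`. -/
def Divides (M : Type*) [AddCommGroup M] [Module R M] (N : Type*) [AddCommGroup N]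
    [Module R N] : Prop :=
  ∃ (ι : Type) (_ : Fintype ι) (f : ι → M →ₗ[R] N) (g : ι → N →ₗ[R] M),
    ∀ x, ∑ i, g i (f i x) = x

variable {R}
variable {L : Type*} [AddCommGroup L] [Module R L]
variable {M : Type*} [AddCommGroup M] [Module R M]
variable {N : Type*} [AddCommGroup N] [Module R N]

theorem IsRetract.refl : IsRetract R M M := ⟨LinearMap.id, LinearMap.id, fun _ => rfl⟩

theorem IsRetract.trans (h : IsRetract R L M) (h' : IsRetract R M N) : IsRetract R L N := by
  obtain ⟨i, p, hip⟩ := h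
  obtain ⟨j, q, hjq⟩ := h'
  exact ⟨j.comp i, p.comp q, fun x => by simp [hip, hjq]⟩

theorem IsRetract.of_equiv (e : M ≃ₗ[R] N) : IsRetract R M N :=
  ⟨e.toLinearMap, e.symm.toLinearMap, fun x => by simp⟩

theorem IsRetract.divides (h : IsRetract R M N) : Divides R M N := by
  obtain ⟨i, p, hip⟩ := h
  exact ⟨Unit, inferInstance, fun _ => i, fun _ => p, fun x => by simp [hip]⟩

theorem IsRetract.of_isCompl {P Q : Submodule R M} (h : IsCompl P Q) : IsRetract R P M :=
  ⟨P.subtype, P.projectionOnto Q h, fun x => by simp⟩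

theorem IsRetract.finite [Module.Finite R N] (h : IsRetract R M N) : Module.Finite R M := by
  obtain ⟨i, p, hip⟩ := h
  exact Module.Finite.of_surjective p fun x => ⟨i x, hip x⟩

theorem Divides.of_isCompl {P Q : Submodule R M} (h : IsCompl P Q) (hP : Divides R P N)
    (hQ : Divides R Q N) : Divides R M N := by
  obtain ⟨ι, _, f, g, hfg⟩ := hP
  obtain ⟨ι', _, f', g', hfg'⟩ := hQ
  refine ⟨ι ⊕ ι', inferInstance,
    Sum.elim (fun i => (f i).comp (P.projectionOnto Q h))
      fun i => (f' i).comp (Q.projectionOnto P h.symm),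
    Sum.elim (fun i => P.subtype.comp (g i)) fun i => Q.subtype.comp (g' i), fun x => ?_⟩
  simp only [Fintype.sum_sum_type, Sum.elim_inl, Sum.elim_inr, LinearMap.comp_apply,
    ← map_sum, hfg, hfg']
  exact Submodule.projection_add_projection_eq_self h x

/-- A module of finite length divides `N` as soon as its indecomposable direct summands do. -/
theorem Divides.of_indecomposable (M : Type u) [AddCommGroup M] [Module R M]
    [IsNoetherian R M] [IsArtinian R M]
    (h : ∀ (Y : Type u) [AddCommGroup Y] [Module R Y], IsIndecomposable R Y → IsRetract R Y M →
      Divides R Y N) : Divides R M N := by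
  -- A decomposable module splits into two proper submodules of strictly smaller length. Only
  -- existence of a decomposition is used, not its uniqueness.
  induction hl : Module.length R M using WellFoundedLT.induction generalizing M with
  | ind l ih =>
    subst hl
    by_cases hM : IsIndecomposable R M
    · exact h M hM IsRetract.refl
    cases subsingleton_or_nontrivial M with
    | inl hs => exact ⟨Empty, inferInstance, Empty.elim, Empty.elim, fun x => Subsingleton.elim _ _⟩
    | inr hn =>
      simp only [IsIndecomposable, hn, true_and] at hM
      push Not at hM
      obtain ⟨P, Q, hPQ, hP, hQ⟩ := hM
      have hP' : P < ⊤ := lt_top_iff_ne_top.2 fun e => hQ (by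
        subst e; exact hPQ.inf_eq_bot ▸ (top_inf_eq Q).symm)
      have hQ' : Q < ⊤ := lt_top_iff_ne_top.2 fun e => hP (by
        subst e; exact hPQ.inf_eq_bot ▸ (inf_top_eq P).symm)
      exact Divides.of_isCompl hPQ
        (ih _ (Submodule.length_lt hP'.ne) P
          (fun Y _ _ hY hYP => h Y hY (hYP.trans (.of_isCompl hPQ))) rfl)
        (ih _ (Submodule.length_lt hQ'.ne) Q
          (fun Y _ _ hY hYQ => h Y hY (hYQ.trans (.of_isCompl hPQ.symm))) rfl)

/-- Over a ring of finite representation type, an ascending chain of modules of finite length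
stabilises up to multiplicities. -/
theorem FiniteRepType.exists_divides {R : Type u} [Ring R] (hR : FiniteRepType R)
    (M : ℕ → Type u) [∀ n, AddCommGroup (M n)] [∀ n, Module R (M n)]
    [∀ n, IsNoetherian R (M n)] [∀ n, IsArtinian R (M n)]
    (h : ∀ n, IsRetract R (M n) (M (n + 1))) : ∃ n, Divides R (M (n + 1)) (M n) := by
  obtain ⟨r, X, hX⟩ := hR
  -- Increasing because retracts compose, and eventually constant because `Fin r` has finitely many
  -- subsets. The listed `X i` need not themselves be indecomposable.
  let S : ℕ →o Set (Fin r) :=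
    { toFun := fun n => {i | IsRetract R (X i) (M n)}
      monotone' := monotone_nat_of_le_succ fun n i hi => IsRetract.trans hi (h n) }
  obtain ⟨n, hn⟩ := WellFoundedGT.monotone_chain_condition S
  refine ⟨n, Divides.of_indecomposable _ fun Y _ _ hY hYM => ?_⟩
  obtain ⟨i, ⟨e⟩⟩ := hX Y hYM.finite hY
  have hi : i ∈ S (n + 1) := IsRetract.trans (.of_equiv e.symm) hYM
  rw [← hn (n + 1) n.le_succ] at hi
  exact (IsRetract.trans (.of_equiv e) hi).divides

end FiniteType

/-! ### Tensor powers as finite-length modules over $B\otimes_k B^{\mathrm{op}}$ -/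

section Enveloping

variable {k : Type v} [Field k] {A : Type u} [Ring A] [Algebra k A]

/-- The two actions of `k` on an `A`-bimodule agree. -/
def IsCentralBimod (k : Type*) [Field k] {A : Type*} [Ring A] [Algebra k A]
    (M : Type*) [AddCommGroup M] [Module A M] [Module Aᵐᵒᵖ M] : Prop :=
  ∀ (r : k) (x : M), MulOpposite.op (algebraMap k A r) • x = algebraMap k A r • x

/-- Scalars lie in $B$, so they cross the tensor sign: $(a\otimes x)r=a\otimes rx=ar\otimes
x=ra\otimes x$. Agreement of the two scalar actions is what lets the tensor product over $k$ act. -/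
theorem IsCentralBimod.balTensor (B : Subalgebra k A)
    {M : Type*} [AddCommGroup M] [Module A M] [Module Aᵐᵒᵖ M] [SMulCommClass A Aᵐᵒᵖ M]
    (hM : IsCentralBimod k (A := A) M) :
    IsCentralBimod k (A := A) (BalTensor B.toSubring A M) := by
  intro r x
  induction x using BalTensor.induction_on with
  | zero => simp
  | add x y hx hy => rw [smul_add, smul_add, hx, hy]
  | tmul a x =>
    rw [BalTensor.right_smul_tmul, BalTensor.left_smul_tmul, hM r x,
      ← BalTensor.smul_tmul B.toSubring (B.algebraMap_mem r)]
    exact congrArg (fun y => BalTensor.tmul B.toSubring y x) (Algebra.commutes r a).symm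

theorem isCentralBimod_tensorPower (B : Subalgebra k A) (n : ℕ) :
    IsCentralBimod k (A := A) (tensorPower B.toSubring n).carrier := by
  induction n with
  | zero => exact fun r (x : A) => (Algebra.commutes r x).symm
  | succ n ih => exact ih.balTensor B

/-- A central `A`-bimodule as a module over `B ⊗ Bᵐᵒᵖ`. -/
theorem exists_envelopingModule (B : Subalgebra k A)
    (M : Type*) [AddCommGroup M] [Module A M] [Module Aᵐᵒᵖ M] [SMulCommClass A Aᵐᵒᵖ M]
    (hM : IsCentralBimod k (A := A) M) :
    ∃ _ : Module (B ⊗[k] Bᵐᵒᵖ) M, ∀ (b c : B) (x : M),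
      (b ⊗ₜ[k] MulOpposite.op c : B ⊗[k] Bᵐᵒᵖ) • x = b.1 • MulOpposite.op c.1 • x := by
  let _ : Module k M := Module.compHom M (algebraMap k A)
  have hk : ∀ (r : k) (x : M), r • x = algebraMap k A r • x := fun _ _ => rfl
  let l : B →ₐ[k] Module.End k M := AlgHom.ofLinearMap
    { toFun := fun b =>
        { toFun := fun x => b.1 • x
          map_add' := smul_add _
          map_smul' := fun r x => by
            simp only [hk, RingHom.id_apply, smul_smul, Algebra.commutes] }
      map_add' := fun b c => LinearMap.ext fun x => add_smul _ _ _
      map_smul' := fun r b => LinearMap.ext fun x => by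
        simp [hk, Algebra.smul_def, mul_smul] }
    (LinearMap.ext fun x => one_smul _ _) fun b c => LinearMap.ext fun x => mul_smul _ _ _
  let r : Bᵐᵒᵖ →ₐ[k] Module.End k M := AlgHom.ofLinearMap
    { toFun := fun b =>
        { toFun := fun x => MulOpposite.op b.unop.1 • x
          map_add' := smul_add _
          map_smul' := fun r x => by
            simp only [hk, RingHom.id_apply, smul_comm] }
      map_add' := fun b c => LinearMap.ext fun x =>
        add_smul (MulOpposite.op b.unop.1) (MulOpposite.op c.unop.1) x
      map_smul' := fun r b => LinearMap.ext fun x => by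
        change MulOpposite.op (r • b.unop.1) • x = algebraMap k A r • MulOpposite.op b.unop.1 • x
        rw [← hM r, smul_smul, ← MulOpposite.op_mul, Algebra.smul_def, Algebra.commutes] }
    (LinearMap.ext fun x => one_smul _ _) fun b c => LinearMap.ext fun x =>
      mul_smul (MulOpposite.op b.unop.1) (MulOpposite.op c.unop.1) x
  have hlr : ∀ b c, Commute (l b) (r c) := fun b c => LinearMap.ext fun x =>
    smul_comm b.1 (MulOpposite.op c.unop.1) x
  exact ⟨Module.compHom M (Algebra.TensorProduct.lift l r hlr).toRingHom, fun b c x =>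
    LinearMap.congr_fun (Algebra.TensorProduct.lift_tmul l r hlr b (MulOpposite.op c)) x⟩

/-- `M` is spanned over `k` by a finite set, with `k` acting through `A` on the left. -/
def IsFinitelySpanned (k : Type*) [Field k] {A : Type*} [Ring A] [Algebra k A]
    (M : Type*) [AddCommGroup M] [Module A M] : Prop :=
  ∃ s : Set M, s.Finite ∧ ∀ P : AddSubgroup M,
    (∀ (r : k), ∀ y ∈ s, algebraMap k A r • y ∈ P) → ∀ x, x ∈ P

theorem isFinitelySpanned_self [FiniteDimensional k A] : IsFinitelySpanned k (A := A) A := by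
  obtain ⟨s, hs⟩ := Module.Finite.fg_top (R := k) (M := A)
  refine ⟨s, s.finite_toSet, fun P hP x => ?_⟩
  have hx : x ∈ Submodule.span k (s : Set A) := hs ▸ Submodule.mem_top
  induction hx using Submodule.closure_induction with
  | zero => exact P.zero_mem
  | add x y _ _ hx hy => exact P.add_mem hx hy
  | smul_mem r y hy => rw [Algebra.smul_def]; exact hP r y hy

/-- Tensors of spanning elements suffice: a scalar on the second factor moves to the first, as it
lies in $B$. -/
theorem IsFinitelySpanned.balTensor [FiniteDimensional k A] (B : Subalgebra k A)
    {M : Type*} [AddCommGroup M] [Module A M] (hM : IsFinitelySpanned k (A := A) M) :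
    IsFinitelySpanned k (A := A) (BalTensor B.toSubring A M) := by
  obtain ⟨s, hs, hsM⟩ := hM
  obtain ⟨t, ht, htA⟩ := isFinitelySpanned_self (k := k) (A := A)
  refine ⟨Set.image2 (BalTensor.tmul B.toSubring) t s, ht.image2 _ hs, fun P hP x => ?_⟩
  have h1 : ∀ y ∈ s, ∀ a : A, BalTensor.tmul B.toSubring a y ∈ P := fun y hy a =>
    htA (P.comap ((BalTensor.tmulHom B.toSubring A M).flip y))
      (fun r a ha => hP r _ (Set.mem_image2_of_mem ha hy)) a
  have h2 : ∀ (a : A) (m : M), BalTensor.tmul B.toSubring a m ∈ P := fun a =>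
    hsM (P.comap (BalTensor.tmulHom B.toSubring A M a)) fun r y hy => by
      change BalTensor.tmul B.toSubring a (algebraMap k A r • y) ∈ P
      rw [← BalTensor.smul_tmul B.toSubring (B.algebraMap_mem r)]
      exact h1 y hy _
  induction x using BalTensor.induction_on with
  | zero => exact P.zero_mem
  | tmul a m => exact h2 a m
  | add x y hx hy => exact P.add_mem hx hy

theorem isFinitelySpanned_tensorPower [FiniteDimensional k A] (B : Subalgebra k A) (n : ℕ) :
    IsFinitelySpanned k (A := A) (tensorPower B.toSubring n).carrier := by
  induction n with
  | zero => exact isFinitelySpanned_self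
  | succ n ih => exact ih.balTensor B

/-- The maps are $x\mapsto 1\otimes x$ and $a\otimes x\mapsto ax$. The first is left $B$-linear
because $b$ crosses the tensor sign; this argument does not extend to all of $A$. -/
theorem exists_balTensor_retraction (B : Subring A)
    (M : Type*) [AddCommGroup M] [Module A M] [Module Aᵐᵒᵖ M] [SMulCommClass A Aᵐᵒᵖ M] :
    ∃ (i : M →+ BalTensor B A M)
      (p : BalTensor B A M →+ M),
      IsBiLinear (B : Set A) (B : Set A) i ∧ IsBiLinear (B : Set A) (B : Set A) p ∧
        ∀ x, p (i x) = x := by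
  let i := BalTensor.tmulHom B A M 1
  let p : BalTensor B A M →+ M :=
    BalTensor.lift (smulAddHom A _) fun b _ a x => mul_smul a b x
  refine ⟨i, p, ⟨fun b hb x => ?_, fun b _ x => rfl⟩, ⟨fun b _ x => ?_, fun b _ x => ?_⟩,
    fun x => one_smul A x⟩
  · refine (BalTensor.smul_tmul B hb 1 x).symm.trans ?_
    exact congrArg (fun a => BalTensor.tmul B a x) ((one_mul b).trans (mul_one b).symm)
  · change p (b • x) = b • p x
    induction x using BalTensor.induction_on with
    | zero => simp
    | tmul a m => exact mul_smul b a m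
    | add x y hx hy => rw [smul_add, map_add, map_add, smul_add, hx, hy]
  · change p (MulOpposite.op b • x) = MulOpposite.op b • p x
    induction x using BalTensor.induction_on with
    | zero => simp
    | tmul a m => exact smul_comm a (MulOpposite.op b) m
    | add x y hx hy => rw [smul_add, map_add, map_add, smul_add, hx, hy]

theorem exists_hasHDepth_of_finiteRepType [FiniteDimensional k A] (B : Subalgebra k A)
    (hB : FiniteRepType (B ⊗[k] Bᵐᵒᵖ)) : ∃ n, HasHDepth B.toSubring n := by
  have : IsArtinianRing (B ⊗[k] Bᵐᵒᵖ) := IsArtinianRing.of_finite k _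
  have : IsNoetherianRing (B ⊗[k] Bᵐᵒᵖ) := IsNoetherianRing.of_finite k _
  choose inst hinst using fun n => exists_envelopingModule B
    (tensorPower B.toSubring n).carrier (isCentralBimod_tensorPower B n)
  have hfin : ∀ n, Module.Finite (B ⊗[k] Bᵐᵒᵖ) (tensorPower B.toSubring n).carrier := fun n => by
    obtain ⟨s, hs, hsM⟩ := isFinitelySpanned_tensorPower B n
    refine ⟨Submodule.fg_def.2 ⟨s, hs, eq_top_iff.2 fun x _ => ?_⟩⟩
    refine hsM (Submodule.span (B ⊗[k] Bᵐᵒᵖ) s).toAddSubgroup (fun r y hy => ?_) x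
    have h := (Submodule.span (B ⊗[k] Bᵐᵒᵖ) s).smul_mem
      (algebraMap k B r ⊗ₜ[k] MulOpposite.op 1) (Submodule.subset_span hy)
    rw [hinst] at h
    simpa using h
  -- Together with `hbil`, this identifies maps linear over $B$ on both sides with $B\otimes_k
  -- B^{\mathrm{op}}$-linear maps.
  have hlin : ∀ (m n : ℕ)
      (f : (tensorPower B.toSubring m).carrier →+ (tensorPower B.toSubring n).carrier),
      IsBiLinear (B.toSubring : Set A) (B.toSubring : Set A) f →
      ∀ (a : B ⊗[k] Bᵐᵒᵖ) x, f (a • x) = a • f x := fun m n f hf a x => by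
    induction a using TensorProduct.induction_on with
    | zero =>
      exact (congrArg f (zero_smul (B ⊗[k] Bᵐᵒᵖ) x)).trans
        ((map_zero f).trans (zero_smul (B ⊗[k] Bᵐᵒᵖ) (f x)).symm)
    | add a b ha hb => rw [add_smul, map_add, add_smul, ha, hb]
    | tmul b c =>
      rw [← MulOpposite.op_unop c, hinst, hinst, hf.left _ b.2, hf.right _ c.unop.2]
  have hbil : ∀ (m n : ℕ) (f : (tensorPower B.toSubring m).carrier →ₗ[B ⊗[k] Bᵐᵒᵖ]
        (tensorPower B.toSubring n).carrier),
      IsBiLinear (B.toSubring : Set A) (B.toSubring : Set A) f.toAddMonoidHom := fun m n f =>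
    ⟨fun b hb x => by
      have h := f.map_smul ((⟨b, hb⟩ : B) ⊗ₜ[k] MulOpposite.op 1) x
      rw [hinst, hinst] at h
      simpa using h, fun b hb x => by
      have h := f.map_smul (1 ⊗ₜ[k] MulOpposite.op (⟨b, hb⟩ : B)) x
      rw [hinst, hinst] at h
      simpa using h⟩
  obtain ⟨n, ι, _, f, g, hfg⟩ := hB.exists_divides
    (fun n => (tensorPower B.toSubring n).carrier) fun n => by
      obtain ⟨i, p, hi, hp, hip⟩ := exists_balTensor_retraction B.toSubring
        (tensorPower B.toSubring n).carrier
      exact ⟨{ i with map_smul' := hlin n (n + 1) i hi },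
        { p with map_smul' := hlin (n + 1) n p hp }, hip⟩
  exact ⟨n + 2, HasHDepth.of_biDivides_subring B.toSubring ⟨ι, inferInstance,
    fun i => (f i).toAddMonoidHom, fun i => (g i).toAddMonoidHom, fun i => hbil _ _ (f i),
    fun i => hbil _ _ (g i), hfg⟩⟩

end Enveloping

/-! ### Group algebras: tensor powers as permutation bimodules -/

section GroupAlgebra

open MonoidAlgebra

variable {k : Type v} [Field k] {G : Type w} [Group G]

/-- The part of an element of the group algebra supported on a given coset. -/
noncomputable def cosetPart (J : Subgroup G) (c : G ⧸ J) :
    MonoidAlgebra k G →+ MonoidAlgebra k G :=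
  AddMonoidHom.mk' (fun a => by
    classical exact ofCoeff (a.coeff.filter fun g => (g : G ⧸ J) = c)) fun a b => by
      simp [Finsupp.filter_add]

open Classical in
theorem cosetPart_single (J : Subgroup G) (c : G ⧸ J) (g : G) (r : k) :
    cosetPart J c (single g r) = if (g : G ⧸ J) = c then single g r else 0 := by
  change ofCoeff (Finsupp.filter _ _) = _
  split_ifs with h
  · rw [coeff_single, Finsupp.filter_single_of_pos (fun x : G => (x : G ⧸ J) = c) h]; rfl
  · rw [coeff_single, Finsupp.filter_single_of_neg (fun x : G => (x : G ⧸ J) = c) h]; rfl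

theorem groupSubalgebra_induction {J : Subgroup G} {p : MonoidAlgebra k G → Prop}
    (zero : p 0) (single : ∀ j ∈ J, ∀ r, p (MonoidAlgebra.single j r))
    (add : ∀ x y, p x → p y → p (x + y)) {b : MonoidAlgebra k G}
    (hb : b ∈ groupSubalgebra k J) : p b := by
  obtain ⟨a, rfl⟩ := hb
  induction a using MonoidAlgebra.induction_linear with
  | zero => simpa using zero
  | add x y hx hy => rw [map_add]; exact add _ _ hx hy
  | single j r => simpa using single j.1 j.2 r

theorem single_mem_groupSubalgebra {J : Subgroup G} {j : G} (hj : j ∈ J) (r : k) :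
    single j r ∈ groupSubalgebra k J :=
  ⟨single ⟨j, hj⟩ r, by simp⟩

/-- Right multiplication by $J$ preserves each left coset $gJ$. This is the balancedness behind
`exists_balTensor_equiv`. -/
theorem cosetPart_mul (J : Subgroup G) (c : G ⧸ J) (a : MonoidAlgebra k G)
    {b : MonoidAlgebra k G} (hb : b ∈ groupSubalgebra k J) :
    cosetPart J c (a * b) = cosetPart J c a * b := by
  classical
  refine groupSubalgebra_induction
    (p := fun b => cosetPart J c (a * b) = cosetPart J c a * b) (by simp) (fun j hj r => ?_)
    (fun x y hx hy => by rw [mul_add, map_add, mul_add, hx, hy]) hb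
  · induction a using MonoidAlgebra.induction_linear with
    | zero => simp
    | add x y hx hy => rw [add_mul, map_add, map_add, add_mul, hx, hy]
    | single g s =>
      have h : ((g * j : G) : G ⧸ J) = g := (QuotientGroup.eq.2 (by simpa using hj)).symm
      simp only [single_mul_single, cosetPart_single, h]
      split_ifs <;> simp

theorem map_smul_of_map_single_smul {M N : Type*} [AddCommGroup M] [Module (MonoidAlgebra k G) M]
    [AddCommGroup N] [Module (MonoidAlgebra k G) N] (f : M →+ N)
    (h : ∀ (g : G) (r : k) x, f (single g r • x) = (single g r : MonoidAlgebra k G) • f x)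
    (a : MonoidAlgebra k G) (x : M) : f (a • x) = a • f x := by
  induction a using MonoidAlgebra.induction_linear with
  | zero => simp
  | add a b ha hb => rw [add_smul, map_add, add_smul, ha, hb]
  | single g r => exact h g r x

/-- `k[G] ⊗_{k[J]} M` is a direct sum of copies of `M`, indexed by `G ⧸ J`. -/
theorem exists_balTensor_equiv [Finite G] (J : Subgroup G)
    (M : Type*) [AddCommGroup M] [Module (MonoidAlgebra k G) M] [Module (MonoidAlgebra k G)ᵐᵒᵖ M]
    [SMulCommClass (MonoidAlgebra k G) (MonoidAlgebra k G)ᵐᵒᵖ M] :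
    ∃ e : BalTensor (groupSubalgebra k J).toSubring (MonoidAlgebra k G) M ≃+ (G ⧸ J → M),
      (∀ (g : G) (r : k) x c,
        e (single g r • x) c = (single g r : MonoidAlgebra k G) • e x (g⁻¹ • c)) ∧
      ∀ (a : (MonoidAlgebra k G)ᵐᵒᵖ) x c, e (a • x) c = a • e x c := by
  classical
  let _ := Fintype.ofFinite (G ⧸ J)
  let B := (groupSubalgebra k J).toSubring
  -- $g\otimes m$ goes to $gm$ in slot $gJ$. Storing $gm$ rather than $m$ avoids choosing
  -- representatives and makes $G$ act diagonally, on slots and on values.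
  let F : BalTensor B (MonoidAlgebra k G) M →+ (G ⧸ J → M) := BalTensor.lift
    (AddMonoidHom.mk' (fun a => AddMonoidHom.mk' (fun m c => cosetPart J c a • m)
        fun m m' => funext fun c => smul_add _ _ _)
      fun a b => AddMonoidHom.ext fun m => funext fun c => by simp [add_smul])
    fun b hb a m => funext fun c => by
      change cosetPart J c (a * b) • m = cosetPart J c a • b • m
      rw [cosetPart_mul J c a hb, mul_smul]
  have hF : ∀ a m c, F (BalTensor.tmul B a m) c = cosetPart J c a • m := fun _ _ _ => rfl
  -- The inverse does choose a representative $t$ of each coset: $g\otimes m=t\otimes t^{-1}gm$,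
  -- because $t^{-1}g\in J$ crosses the tensor sign.
  let H : (G ⧸ J → M) →+ BalTensor B (MonoidAlgebra k G) M := AddMonoidHom.mk'
    (fun φ => ∑ c, BalTensor.tmul B (single c.out 1)
      ((single c.out⁻¹ 1 : MonoidAlgebra k G) • φ c)) fun φ ψ => by
        simp [smul_add, BalTensor.tmul_add, Finset.sum_add_distrib]
  have hH : ∀ φ, H φ = ∑ c, BalTensor.tmul B (single c.out 1)
      ((single c.out⁻¹ 1 : MonoidAlgebra k G) • φ c) := fun _ => rfl
  have hHF : H.comp F = AddMonoidHom.id _ := BalTensor.hom_ext B fun a m => by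
    induction a using MonoidAlgebra.induction_linear with
    | zero => simp [BalTensor.zero_tmul]
    | add a b ha hb => rw [BalTensor.add_tmul, map_add, map_add, ha, hb]
    | single g r =>
      rw [AddMonoidHom.comp_apply, hH, Finset.sum_eq_single (g : G ⧸ J)]
      · have hg : (g : G ⧸ J).out⁻¹ * g ∈ J := QuotientGroup.eq.1 (QuotientGroup.out_eq' _)
        rw [hF, cosetPart_single, if_pos rfl, smul_smul, single_mul_single,
          ← BalTensor.smul_tmul B (single_mem_groupSubalgebra hg _)]
        simp [MulOpposite.smul_eq_mul_unop]
      · intro c _ hc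
        rw [hF, cosetPart_single, if_neg (Ne.symm hc)]
        simp [BalTensor.tmul_zero]
      · simp
  have hFH : ∀ φ, F (H φ) = φ := fun φ => funext fun c => by
    rw [hH, map_sum, Finset.sum_apply, Finset.sum_eq_single c]
    · rw [hF, cosetPart_single, if_pos (QuotientGroup.out_eq' c), smul_smul]
      simp [← one_def]
    · intro d _ hd
      rw [hF, cosetPart_single, if_neg (by rwa [QuotientGroup.out_eq' d]), zero_smul]
    · simp
  refine ⟨{ F with invFun := H, left_inv := DFunLike.congr_fun hHF, right_inv := hFH },
    fun g r x c => ?_, fun a x c => ?_⟩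
  · change F (single g r • x) c = (single g r : MonoidAlgebra k G) • F x (g⁻¹ • c)
    induction x using BalTensor.induction_on with
    | zero => simp
    | add x y hx hy => simp only [smul_add, map_add, Pi.add_apply, hx, hy]
    | tmul a m =>
      rw [BalTensor.left_smul_tmul, hF, hF, smul_smul]
      congr 1
      induction a using MonoidAlgebra.induction_linear with
      | zero => simp
      | add a b ha hb => rw [smul_add, map_add, map_add, mul_add, ha, hb]
      | single g' s =>
        have h : ((g * g' : G) : G ⧸ J) = c ↔ (g' : G ⧸ J) = g⁻¹ • c := by
          rw [eq_inv_smul_iff]; rfl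
        rw [smul_eq_mul, single_mul_single, cosetPart_single, cosetPart_single]
        simp only [h]
        split_ifs <;> simp [single_mul_single]
  · change F (a • x) c = a • F x c
    induction x using BalTensor.induction_on with
    | zero => simp
    | add x y hx hy => simp only [smul_add, map_add, Pi.add_apply, hx, hy]
    | tmul b m =>
      rw [BalTensor.right_smul_tmul, hF, hF, smul_comm]

/-- `C_{n+1}(k[G], k[J])` is the permutation bimodule on `(G ⧸ J)ⁿ × G`. -/
theorem exists_tensorPower_equiv [Finite G] (J : Subgroup G) (n : ℕ) :
    ∃ e : (tensorPower (groupSubalgebra k J).toSubring n).carrier ≃+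
        ((Fin n → G ⧸ J) → MonoidAlgebra k G),
      (∀ (g : G) (r : k) x w, e ((single g r : MonoidAlgebra k G) • x) w =
        single g r * e x fun i => g⁻¹ • w i) ∧
      ∀ (a : MonoidAlgebra k G) x w, e (MulOpposite.op a • x) w = e x w * a := by
  induction n with
  | zero =>
    let e : MonoidAlgebra k G ≃+ ((Fin 0 → G ⧸ J) → MonoidAlgebra k G) :=
      { toFun := fun a _ => a
        invFun := fun f => f Fin.elim0
        left_inv := fun _ => rfl
        right_inv := fun f => funext fun w => congrArg f (Subsingleton.elim _ _)
        map_add' := fun _ _ => rfl }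
    exact ⟨e, fun _ _ _ _ => rfl, fun _ _ _ => rfl⟩
  | succ n ih =>
    obtain ⟨e, hel, her⟩ := ih
    obtain ⟨e', hel', her'⟩ := exists_balTensor_equiv (k := k) J
      (tensorPower (groupSubalgebra k J).toSubring n).carrier
    let E : ((G ⧸ J) → (tensorPower (groupSubalgebra k J).toSubring n).carrier) ≃+
        ((Fin (n + 1) → G ⧸ J) → MonoidAlgebra k G) :=
      { toFun := fun φ w => e (φ (w 0)) (Fin.tail w)
        invFun := fun ψ c => e.symm fun w => ψ (Fin.cons c w)
        left_inv := fun φ => by simp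
        right_inv := fun ψ => by simp
        map_add' := fun φ ψ => by ext1 w; simp }
    refine ⟨e'.trans E, fun g r x w => ?_, fun a x w => ?_⟩
    · change e (e' _ (w 0)) (Fin.tail w) = single g r * e (e' x (g⁻¹ • w 0)) _
      exact (congrArg (fun y => e y (Fin.tail w)) (hel' g r x (w 0))).trans (hel g r _ _)
    · change e (e' _ (w 0)) (Fin.tail w) = e (e' x (w 0)) (Fin.tail w) * a
      exact (congrArg (fun y => e y (Fin.tail w)) (her' _ x (w 0))).trans (her a _ _)

theorem hasHDepth_groupSubalgebra [Finite G] (J : Subgroup G) :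
    HasHDepth (groupSubalgebra k J).toSubring (Nat.card (G ⧸ J)) := by
  classical
  let _ := Fintype.ofFinite (G ⧸ J)
  set n := Nat.card (G ⧸ J) with hn
  obtain ⟨e, hel, her⟩ := exists_tensorPower_equiv (k := k) J n
  obtain ⟨e', hel', her'⟩ := exists_tensorPower_equiv (k := k) J (n + 1)
  -- Pigeonhole. In a pair $(i,j)$, $j$ is the position to delete and $i$ is where an equal entry
  -- sits in the shortened tuple.
  have hex : ∀ w : Fin (n + 1) → G ⧸ J, ∃ ij : Fin n × Fin (n + 1),
      w ij.2 = w (ij.2.succAbove ij.1) := fun w => by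
    obtain ⟨i, j, hij, h⟩ := Fintype.exists_ne_map_eq_of_card_lt w (by
      rw [← Nat.card_eq_fintype_card, Fintype.card_fin]; exact Nat.lt_succ_self n)
    obtain ⟨l, rfl⟩ := Fin.exists_succAbove_eq hij
    exact ⟨(l, j), h.symm⟩
  -- `epsilon` depends only on the predicate, and translating a tuple by $G$ does not change which
  -- entries coincide. So this choice is automatically $G$-invariant, as `hpg` records.
  let p : (Fin (n + 1) → G ⧸ J) → Fin n × Fin (n + 1) := fun w =>
    Classical.epsilon (h := ⟨(hex w).choose⟩) fun ij : Fin n × Fin (n + 1) =>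
      w ij.2 = w (ij.2.succAbove ij.1)
  have hp : ∀ w : Fin (n + 1) → G ⧸ J, w (p w).2 = w ((p w).2.succAbove (p w).1) := fun w =>
    Classical.epsilon_spec (hex w)
  have hpg : ∀ (g : G) (w : Fin (n + 1) → G ⧸ J), p (fun i => g • w i) = p w := fun g w => by
    simp only [p, smul_left_cancel_iff]
  let ins : Fin n × Fin (n + 1) → (Fin n → G ⧸ J) → Fin (n + 1) → G ⧸ J :=
    fun ij w => ij.2.insertNth (w ij.1) w
  have hins : ∀ ij (g : G) w, ins ij (fun i => g • w i) = fun i => g • ins ij w i :=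
    fun ij g w => by
      ext1 i
      rcases eq_or_ne i ij.2 with rfl | h
      · simp [ins]
      · obtain ⟨l, rfl⟩ := Fin.exists_succAbove_eq h
        simp [ins]
  have hdrop : ∀ w : Fin (n + 1) → G ⧸ J, ins (p w) (fun i => w ((p w).2.succAbove i)) = w := fun w => by
    ext1 i
    rcases eq_or_ne i (p w).2 with h | h
    · rw [h]; simp [ins, hp w]
    · obtain ⟨l, hl⟩ := Fin.exists_succAbove_eq h
      rw [← hl]; simp [ins]
  -- `f ij` restricts a function to the tuples with a copied entry; `g ij` extends by zero from the
  -- tuples whose chosen pair is `ij`. Each tuple has exactly one chosen pair, so the composites sum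
  -- to the identity.
  let f : Fin n × Fin (n + 1) → ((Fin (n + 1) → G ⧸ J) → MonoidAlgebra k G) →+
      ((Fin n → G ⧸ J) → MonoidAlgebra k G) := fun ij =>
    AddMonoidHom.mk' (fun φ w => φ (ins ij w)) fun _ _ => rfl
  let g : Fin n × Fin (n + 1) → ((Fin n → G ⧸ J) → MonoidAlgebra k G) →+
      ((Fin (n + 1) → G ⧸ J) → MonoidAlgebra k G) := fun ij =>
    AddMonoidHom.mk' (fun ψ w => if p w = ij then ψ fun i => w (ij.2.succAbove i) else 0)
      fun _ _ => by ext1 w; by_cases h : p w = ij <;> simp [h]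
  refine HasHDepth.of_biDivides ⟨Fin n × Fin (n + 1), inferInstance,
    fun ij => (e.symm.toAddMonoidHom.comp (f ij)).comp e'.toAddMonoidHom,
    fun ij => (e'.symm.toAddMonoidHom.comp (g ij)).comp e.toAddMonoidHom,
    fun ij => ⟨fun a _ => map_smul_of_map_single_smul _ (fun c r x => ?_) a, fun a _ x => ?_⟩,
    fun ij => ⟨fun a _ => map_smul_of_map_single_smul _ (fun c r x => ?_) a, fun a _ x => ?_⟩,
    fun x => ?_⟩
  · refine e.symm_apply_eq.2 (funext fun w => ?_)
    rw [hel]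
    simp [f, hel', hins]
  · refine e.symm_apply_eq.2 (funext fun w => ?_)
    rw [her]
    simp [f, her']
  · refine e'.symm_apply_eq.2 (funext fun w => ?_)
    rw [hel']
    simp [g, hel, hpg]
  · refine e'.symm_apply_eq.2 (funext fun w => ?_)
    rw [her']
    simp [g, her]
  · refine e'.injective (funext fun w => ?_)
    simp [g, f, hdrop]

end GroupAlgebra

end HDepth

theorem corollary2p6 :
    (∀ (k : Type v) [Field k] (A : Type u) [Ring A] [Algebra k A] [FiniteDimensional k A]
      (B : Subalgebra k A), HDepth.FiniteRepType (B ⊗[k] Bᵐᵒᵖ) →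
        HDepth.minHDepth B.toSubring < ⊤) ∧
    (∀ (k : Type v) [Field k] (G : Type w) [Group G] [Finite G] (J : Subgroup G),
      HDepth.minHDepth (HDepth.groupSubalgebra k J).toSubring < ⊤) := by
  refine ⟨fun k _ A _ _ _ B hB => ?_, fun k _ G _ _ J => ?_⟩
  · obtain ⟨n, hn⟩ := HDepth.exists_hasHDepth_of_finiteRepType B hB
    exact hn.minHDepth_lt_top
  · exact (HDepth.hasHDepth_groupSubalgebra J).minHDepth_lt_top
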